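/- Let $G$ be a finite group and let $n$ be a positive integer. Let $D(G)$ be the Drinfel'd double of $G$ over $\mathbb{C}$, that is, the Hopf algebra with basis $p_x\otimes g$ ($x,g\in G$), product $(p_x\otimes g)(p_y\otimes h)=\delta_{x,\,gyg^{-1}}\,p_x\otimes gh$, unit $\sum_{x}p_x\otimes 1$, coproduct $\Delta(p_x\otimes g)=\sum_{ab=x}(p_a\otimes g)\otimes(p_b\otimes g)$, counit $\varepsilon(p_x\otimes g)=\delta_{x,1}$ and antipode $S(p_x\otimes g)=p_{g^{-1}x^{-1}g}\otimes g^{-1}$. Let $\Lambda=|G|^{-1}\sum_{g\in G}p_1\otimes g$ be its normalized integral. For an irreducible representation $V$ of $D(G)$ with character $\chi$, the $n$-th Frobenius–Schur indicator is $\nu_n(V)=\chi(\Lambda^{[n]})$, where $h^{[n]}=h_1h_2\cdots h_n$ in Sweedler notation. The group $G$ is called an $FSZ_n$-group if $\nu_n(V)\in\mathbb{Z}$ for every irreducible representation $V$ of $D(G)$. For $u,g\in G$ put $$G_n(u,g)=\{a\in G \mid (au^{-1})^n=a^n=g\}.$$ Then $G$ is an $FSZ_n$-group if and only if $$|G_n(u,g)|=|G_n(u,g^m)|$$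 for all commuting pairs of elements $u,g\in G$ and all integers $m$ with $\gcd(m,|G|)=1$. -/

import Mathlib

open scoped TensorProduct

universe u

/-- The Sweedler power `h ↦ h₁ h₂ ⋯ hₙ` of a bialgebra (with `h ↦ ε(h) 1` for `n = 0`). -/
noncomputable def sweedlerPow (R : Type*) (H : Type*) [CommRing R] [Ring H] [Bialgebra R H] :
    ℕ → (H →ₗ[R] H)
  | 0 => Algebra.linearMap R H ∘ₗ Coalgebra.counit
  | n + 1 => LinearMap.mul' R H ∘ₗ
      TensorProduct.map (sweedlerPow R H n) LinearMap.id ∘ₗ Coalgebra.comul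

/-- A normalized two-sided integral of a bialgebra. -/
structure IsNormalizedIntegral (R : Type*) {H : Type*} [CommRing R] [Ring H] [Bialgebra R H]
    (Λ : H) : Prop where
  left : ∀ h : H, h * Λ = Coalgebra.counit (R := R) h • Λ
  right : ∀ h : H, Λ * h = Coalgebra.counit (R := R) h • Λ
  counit_eq_one : Coalgebra.counit (R := R) Λ = 1

/-- The character of an `H`-module `V`: `h ↦ tr(h | V)`. -/
noncomputable def moduleCharacter (R H V : Type*) [CommRing R] [Ring H] [Algebra R H]
    [AddCommGroup V] [Module R V] [Module H V] [IsScalarTower R H V] : H →ₗ[R] R :=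
  LinearMap.trace R V ∘ₗ (Algebra.lsmul R R V : H →ₐ[R] Module.End R V).toLinearMap

/-- The `n`-th Frobenius–Schur indicator `χ_V(Λ^[n])`, computed with the integral `Λ`. -/
noncomputable def fsIndicator (R : Type*) {H : Type*} [CommRing R] [Ring H] [Bialgebra R H]
    (Λ : H) (n : ℕ) (V : Type*) [AddCommGroup V] [Module R V] [Module H V]
    [IsScalarTower R H V] : R :=
  moduleCharacter R H V (sweedlerPow R H n Λ)

/-- The underlying space of the Drinfel'd double `D(G)` over `ℂ`: the function `f` stands for
`∑ x g, f x g • (p_x ⊗ g)`, where `p_x` is the delta function at `x`. -/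
def DrinfeldDouble (G : Type u) : Type u := G → G → ℂ

namespace DrinfeldDouble

variable {G : Type u}

noncomputable instance : AddCommGroup (DrinfeldDouble G) :=
  inferInstanceAs (AddCommGroup (G → G → ℂ))

noncomputable instance : Module ℂ (DrinfeldDouble G) :=
  inferInstanceAs (Module ℂ (G → G → ℂ))

@[ext] theorem ext {f h : DrinfeldDouble G} (H : ∀ x g, f x g = h x g) : f = h :=
  funext fun x => funext fun g => H x g

@[simp] theorem zero_apply (x g : G) : (0 : DrinfeldDouble G) x g = 0 := rfl

@[simp] theorem add_apply (f h : DrinfeldDouble G) (x g : G) : (f + h) x g = f x g + h x g := rfl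

@[simp] theorem smul_apply (c : ℂ) (f : DrinfeldDouble G) (x g : G) :
    (c • f) x g = c * f x g := rfl

/-- Evaluation at `(x, g)` as a linear form. -/
def coeff (x g : G) : DrinfeldDouble G →ₗ[ℂ] ℂ where
  toFun f := f x g
  map_add' _ _ := rfl
  map_smul' _ _ := rfl

theorem sum_apply {ι : Type*} (s : Finset ι) (F : ι → DrinfeldDouble G) (x g : G) :
    (∑ i ∈ s, F i) x g = ∑ i ∈ s, F i x g :=
  map_sum (coeff x g) F s

variable [DecidableEq G]

/-- The basis element `p_x ⊗ g`. -/
def single (x g : G) : DrinfeldDouble G := fun y k => if y = x ∧ k = g then 1 else 0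

theorem single_apply (x g y k : G) :
    single x g y k = if y = x ∧ k = g then (1 : ℂ) else 0 := rfl

variable [Fintype G]

theorem eq_sum_single (f : DrinfeldDouble G) : f = ∑ x, ∑ g, f x g • single x g := by
  ext y k
  simp [sum_apply, single_apply, ite_and]

theorem linearMap_ext {M : Type*} [AddCommMonoid M] [Module ℂ M]
    {φ ψ : DrinfeldDouble G →ₗ[ℂ] M} (h : ∀ x g, φ (single x g) = ψ (single x g)) : φ = ψ := by
  refine LinearMap.ext fun f => ?_
  rw [eq_sum_single f]
  simp [map_sum, h]

variable [Group G]

instance : One (DrinfeldDouble G) := ⟨fun _ g => if g = 1 then 1 else 0⟩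

/-- The product of `D(G)`, determined by
`(p_x ⊗ g) (p_y ⊗ h) = δ_{x, g y g⁻¹} (p_x ⊗ g h)`; see `single_mul_single`. -/
noncomputable instance : Mul (DrinfeldDouble G) :=
  ⟨fun f h x g => ∑ k, f x k * h (k⁻¹ * x * k) (k⁻¹ * g)⟩

theorem one_apply (x g : G) : (1 : DrinfeldDouble G) x g = if g = 1 then 1 else 0 := rfl

theorem mul_apply (f h : DrinfeldDouble G) (x g : G) :
    (f * h) x g = ∑ k, f x k * h (k⁻¹ * x * k) (k⁻¹ * g) := rfl

noncomputable instance : Ring (DrinfeldDouble G) :=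
  { (inferInstance : AddCommGroup (DrinfeldDouble G)),
    (inferInstance : One (DrinfeldDouble G)),
    (inferInstance : Mul (DrinfeldDouble G)) with
    left_distrib := fun a b c => by
      ext x g; simp [mul_apply, mul_add, Finset.sum_add_distrib]
    right_distrib := fun a b c => by
      ext x g; simp [mul_apply, add_mul, Finset.sum_add_distrib]
    zero_mul := fun a => by ext x g; simp [mul_apply]
    mul_zero := fun a => by ext x g; simp [mul_apply]
    one_mul := fun a => by ext x g; simp [mul_apply, one_apply]
    mul_one := fun a => by
      ext x g
      simp only [mul_apply, one_apply, inv_mul_eq_one]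
      simp
    mul_assoc := fun a b c => by
      ext x g
      simp only [mul_apply, Finset.sum_mul, Finset.mul_sum]
      rw [Finset.sum_comm]
      refine Finset.sum_congr rfl fun k _ => ?_
      refine Fintype.sum_equiv (Equiv.mulLeft k⁻¹) _ _ fun l => ?_
      simp [mul_assoc] }

noncomputable instance : Algebra ℂ (DrinfeldDouble G) :=
  Algebra.ofModule
    (fun c f h => by ext x g; simp [mul_apply, Finset.mul_sum, mul_assoc])
    (fun c f h => by ext x g; simp [mul_apply, Finset.mul_sum, mul_left_comm])

theorem single_mul_single (x g y h : G) :
    single x g * single y h = if x = g * y * g⁻¹ then single x (g * h) else 0 := by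
  ext z k
  rw [mul_apply, Finset.sum_eq_single g]
  · by_cases hz : z = x
    · subst hz
      have e1 : (g⁻¹ * z * g = y) ↔ (z = g * y * g⁻¹) := by
        constructor
        · rintro rfl; group
        · rintro rfl; group
      have e2 : (g⁻¹ * k = h) ↔ (k = g * h) := inv_mul_eq_iff_eq_mul
      by_cases h1 : z = g * y * g⁻¹
      · rw [if_pos h1]
        simp [single_apply, e1.2 h1, e2]
      · rw [if_neg h1]
        simp [single_apply, e1, h1]
    · split_ifs <;> simp [single_apply, hz]
  · intro l _ hl
    simp [single_apply, hl]
  · simp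

theorem one_eq_sum : (1 : DrinfeldDouble G) = ∑ x, single x 1 := by
  ext y k
  simp [sum_apply, single_apply, one_apply, ite_and]

/-- The coproduct of `D(G)`, determined by
`Δ(p_x ⊗ g) = ∑_{ab = x} (p_a ⊗ g) ⊗ (p_b ⊗ g)`, and the counit, determined by
`ε(p_x ⊗ g) = δ_{x, 1}`.  (Reversing the two tensor factors of `Δ` gives an isomorphic Hopf algebra,
by `p_x ⊗ g ↦ p_{x⁻¹} ⊗ g`.) -/
noncomputable instance : CoalgebraStruct ℂ (DrinfeldDouble G) where
  comul :=
    { toFun := fun f => ∑ a, ∑ b, ∑ g, f (a * b) g • (single a g ⊗ₜ[ℂ] single b g)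
      map_add' := fun f h => by simp [add_smul, Finset.sum_add_distrib]
      map_smul' := fun c f => by simp [Finset.smul_sum, mul_smul] }
  counit :=
    { toFun := fun f => ∑ g, f 1 g
      map_add' := fun f h => by simp [Finset.sum_add_distrib]
      map_smul' := fun c f => by simp [Finset.mul_sum] }

theorem comul_apply (f : DrinfeldDouble G) :
    CoalgebraStruct.comul (R := ℂ) f =
      ∑ a, ∑ b, ∑ g, f (a * b) g • (single a g ⊗ₜ[ℂ] single b g) := rfl

theorem counit_apply (f : DrinfeldDouble G) :
    CoalgebraStruct.counit (R := ℂ) f = ∑ g, f 1 g := rfl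

theorem comul_single (x g : G) :
    CoalgebraStruct.comul (R := ℂ) (single x g) =
      ∑ a, single a g ⊗ₜ[ℂ] single (a⁻¹ * x) g := by
  rw [comul_apply]
  refine Finset.sum_congr rfl fun a _ => ?_
  rw [Finset.sum_eq_single (a⁻¹ * x)]
  · rw [Finset.sum_eq_single g] <;> simp +contextual [single_apply]
  · intro b _ hb
    refine Finset.sum_eq_zero fun k _ => ?_
    have : a * b ≠ x := fun h => hb (by rw [← h]; group)
    simp [single_apply, this]
  · simp

theorem counit_single (x g : G) :
    CoalgebraStruct.counit (R := ℂ) (single x g) = if x = 1 then 1 else 0 := by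
  by_cases hx : x = 1
  · simp [counit_apply, single_apply, hx]
  · simp [counit_apply, single_apply, hx, Ne.symm hx]

noncomputable instance : Coalgebra ℂ (DrinfeldDouble G) where
  coassoc := by
    refine linearMap_ext fun x g => ?_
    simp only [LinearMap.comp_apply, LinearEquiv.coe_coe, comul_single, map_sum,
      LinearMap.rTensor_tmul, LinearMap.lTensor_tmul, TensorProduct.sum_tmul,
      TensorProduct.tmul_sum, TensorProduct.assoc_tmul]
    rw [Finset.sum_comm]
    refine Finset.sum_congr rfl fun a _ => ?_
    refine Fintype.sum_equiv (Equiv.mulLeft a⁻¹) _ _ fun b => ?_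
    simp [mul_assoc]
  rTensor_counit_comp_comul := by
    refine linearMap_ext fun x g => ?_
    simp only [LinearMap.comp_apply, comul_single, map_sum, LinearMap.rTensor_tmul, counit_single]
    rw [Finset.sum_eq_single 1] <;> simp +contextual
  lTensor_counit_comp_comul := by
    refine linearMap_ext fun x g => ?_
    simp only [LinearMap.comp_apply, comul_single, map_sum, LinearMap.lTensor_tmul, counit_single,
      inv_mul_eq_one]
    rw [Finset.sum_eq_single x] <;> simp +contextual

theorem counit_one' : Coalgebra.counit (R := ℂ) (1 : DrinfeldDouble G) = 1 := by
  simp [counit_apply, one_apply]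

theorem counit_mul' (f h : DrinfeldDouble G) :
    Coalgebra.counit (R := ℂ) (f * h) = Coalgebra.counit f * Coalgebra.counit h := by
  simp only [counit_apply, mul_apply, Finset.sum_mul_sum]
  rw [Finset.sum_comm]
  refine Finset.sum_congr rfl fun k _ => ?_
  refine Fintype.sum_equiv (Equiv.mulLeft k⁻¹) _ _ fun l => ?_
  simp

theorem comul_one' : Coalgebra.comul (R := ℂ) (1 : DrinfeldDouble G) = 1 := by
  rw [Algebra.TensorProduct.one_def, one_eq_sum, map_sum]
  simp only [comul_single, TensorProduct.sum_tmul, TensorProduct.tmul_sum]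
  rw [Finset.sum_comm]
  conv_rhs => rw [Finset.sum_comm]
  refine Finset.sum_congr rfl fun a _ => ?_
  exact Fintype.sum_equiv (Equiv.mulLeft a⁻¹) _ _ fun b => rfl

theorem comul_mul' (f h : DrinfeldDouble G) :
    Coalgebra.comul (R := ℂ) (f * h) = Coalgebra.comul f * Coalgebra.comul h := by
  suffices H : (LinearMap.mul ℂ (DrinfeldDouble G)).compr₂ Coalgebra.comul =
      (LinearMap.mul ℂ (DrinfeldDouble G ⊗[ℂ] DrinfeldDouble G)).compl₁₂
        Coalgebra.comul Coalgebra.comul from LinearMap.congr_fun₂ H f h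
  refine linearMap_ext fun x g => linearMap_ext fun y k => ?_
  simp only [LinearMap.compr₂_apply, LinearMap.compl₁₂_apply, LinearMap.mul_apply',
    single_mul_single, comul_single, Finset.sum_mul, Finset.mul_sum,
    Algebra.TensorProduct.tmul_mul_tmul]
  have inner : ∀ a : G, ∑ b : G,
      ((if a = g * b * g⁻¹ then single a (g * k) else 0) ⊗ₜ[ℂ]
        (if a⁻¹ * x = g * (b⁻¹ * y) * g⁻¹ then single (a⁻¹ * x) (g * k) else 0) :
          DrinfeldDouble G ⊗[ℂ] DrinfeldDouble G) =
      if x = g * y * g⁻¹ then single a (g * k) ⊗ₜ[ℂ] single (a⁻¹ * x) (g * k) else 0 := by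
    intro a
    rw [Finset.sum_eq_single (g⁻¹ * a * g)]
    · have e1 : a = g * (g⁻¹ * a * g) * g⁻¹ := by group
      have e2 : (a⁻¹ * x = g * ((g⁻¹ * a * g)⁻¹ * y) * g⁻¹) ↔ (x = g * y * g⁻¹) := by
        have : g * ((g⁻¹ * a * g)⁻¹ * y) * g⁻¹ = a⁻¹ * (g * y * g⁻¹) := by group
        rw [this, mul_right_inj]
      rw [if_pos e1]
      by_cases h1 : x = g * y * g⁻¹
      · rw [if_pos (e2.2 h1), if_pos h1]
      · rw [if_neg (fun h => h1 (e2.1 h)), if_neg h1, TensorProduct.tmul_zero]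
    · intro b _ hb
      have : a ≠ g * b * g⁻¹ := by rintro rfl; exact hb (by group)
      rw [if_neg this, TensorProduct.zero_tmul]
    · simp
  rw [Finset.sum_comm, Finset.sum_congr rfl fun a _ => inner a]
  split_ifs
  · rw [comul_single]
  · simp

noncomputable instance : Bialgebra ℂ (DrinfeldDouble G) :=
  Bialgebra.mk' ℂ (DrinfeldDouble G) counit_one' (fun {a b} => counit_mul' a b) comul_one'
    (fun {a b} => comul_mul' a b)

/-- The antipode of `D(G)`: `S(p_x ⊗ g) = p_{g⁻¹ x⁻¹ g} ⊗ g⁻¹`; see `antipodeMap_single`. -/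
def antipodeMap : DrinfeldDouble G →ₗ[ℂ] DrinfeldDouble G where
  toFun f := fun y k => f (k⁻¹ * y⁻¹ * k) k⁻¹
  map_add' _ _ := rfl
  map_smul' _ _ := rfl

theorem antipodeMap_single (x g : G) :
    antipodeMap (single x g) = single (g⁻¹ * x⁻¹ * g) g⁻¹ := by
  ext y k
  change (if k⁻¹ * y⁻¹ * k = x ∧ k⁻¹ = g then (1 : ℂ) else 0) =
    if y = g⁻¹ * x⁻¹ * g ∧ k = g⁻¹ then 1 else 0
  congr 1
  refine propext ⟨?_, ?_⟩
  · rintro ⟨rfl, rfl⟩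
    exact ⟨by group, by group⟩
  · rintro ⟨rfl, rfl⟩
    exact ⟨by group, by group⟩

noncomputable instance : HopfAlgebra ℂ (DrinfeldDouble G) where
  antipode := antipodeMap
  mul_antipode_rTensor_comul := by
    refine linearMap_ext fun x g => ?_
    simp only [LinearMap.comp_apply, comul_single, map_sum, LinearMap.rTensor_tmul,
      antipodeMap_single, LinearMap.mul'_apply, single_mul_single, counit_single,
      Algebra.linearMap_apply]
    have e : ∀ a : G, (g⁻¹ * a⁻¹ * g = g⁻¹ * (a⁻¹ * x) * g⁻¹⁻¹) ↔ x = 1 := fun a => by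
      simp [mul_assoc]
    simp only [e]
    split_ifs
    · rw [map_one, one_eq_sum]
      refine Fintype.sum_equiv ((Equiv.inv G).trans (MulAut.conj g⁻¹).toEquiv) _ _ fun a => ?_
      simp
    · simp
  mul_antipode_lTensor_comul := by
    refine linearMap_ext fun x g => ?_
    simp only [LinearMap.comp_apply, comul_single, map_sum, LinearMap.lTensor_tmul,
      antipodeMap_single, LinearMap.mul'_apply, single_mul_single, counit_single,
      Algebra.linearMap_apply]
    have e : ∀ a : G, (a = g * (g⁻¹ * (a⁻¹ * x)⁻¹ * g) * g⁻¹) ↔ x = 1 := fun a => by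
      have : g * (g⁻¹ * (a⁻¹ * x)⁻¹ * g) * g⁻¹ = x⁻¹ * a := by group
      rw [this, eq_comm, mul_eq_right, inv_eq_one]
    simp only [e]
    split_ifs
    · rw [map_one, one_eq_sum]
      simp
    · simp

/-- The normalized integral `|G|⁻¹ ∑_g p_1 ⊗ g` of `D(G)`. -/
noncomputable def integral (G : Type u) [Group G] [Fintype G] [DecidableEq G] : DrinfeldDouble G :=
  (Fintype.card G : ℂ)⁻¹ • ∑ g : G, single 1 g

theorem isNormalizedIntegral_integral : IsNormalizedIntegral ℂ (integral G) where
  left h := by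
    have : LinearMap.mulRight ℂ (integral G) =
        (Coalgebra.counit (R := ℂ) (A := DrinfeldDouble G)).smulRight (integral G) := by
      refine linearMap_ext fun x g => ?_
      simp only [LinearMap.mulRight_apply, LinearMap.smulRight_apply, counit_single, integral,
        mul_smul_comm, Finset.mul_sum, single_mul_single]
      by_cases hx : x = 1
      · subst hx
        simp only [mul_one, mul_inv_cancel, if_true, one_smul]
        congr 1
        exact Fintype.sum_equiv (Equiv.mulLeft g) _ _ fun k => rfl
      · simp [hx]
    exact LinearMap.congr_fun this h
  right h := by
    have : LinearMap.mulLeft ℂ (integral G) =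
        (Coalgebra.counit (R := ℂ) (A := DrinfeldDouble G)).smulRight (integral G) := by
      refine linearMap_ext fun x g => ?_
      simp only [LinearMap.mulLeft_apply, LinearMap.smulRight_apply, counit_single, integral,
        smul_mul_assoc, Finset.sum_mul, single_mul_single]
      have e : ∀ k : G, (1 = k * x * k⁻¹) ↔ x = 1 := fun k => by
        rw [eq_comm, conj_eq_one_iff]
      simp only [e]
      by_cases hx : x = 1
      · subst hx
        simp only [if_true, one_smul]
        congr 1
        exact Fintype.sum_equiv (Equiv.mulRight g) _ _ fun k => rfl
      · simp [hx]
    exact LinearMap.congr_fun this h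
  counit_eq_one := by
    simp [integral, counit_single]

end DrinfeldDouble

/-- The normalized integral is unique. -/
theorem IsNormalizedIntegral.unique {R H : Type*} [CommRing R] [Ring H] [Bialgebra R H]
    {Λ Λ' : H} (h : IsNormalizedIntegral R Λ) (h' : IsNormalizedIntegral R Λ') : Λ = Λ' := by
  have h1 := h.right Λ'
  have h2 := h'.left Λ
  rw [h'.counit_eq_one, one_smul] at h1
  rw [h.counit_eq_one, one_smul] at h2
  exact h1.symm.trans h2

/-- `G` is an `FSZ_n`-group: for every irreducible representation `V` of `D(G)`, the `n`-th
Frobenius–Schur indicator of `V` is a rational integer.  (Every simple `D(G)`-module is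
finite-dimensional and isomorphic to a quotient of `D(G)`, so that the universe of `G` suffices.) -/
def IsFSZ (G : Type u) [Group G] [Fintype G] [DecidableEq G] (n : ℕ) : Prop :=
  ∀ (V : Type u) [AddCommGroup V] [Module ℂ V] [Module (DrinfeldDouble G) V]
    [IsScalarTower ℂ (DrinfeldDouble G) V] [FiniteDimensional ℂ V]
    [IsSimpleModule (DrinfeldDouble G) V],
    ∃ z : ℤ, fsIndicator ℂ (DrinfeldDouble.integral G) n V = (z : ℂ)

/-- The set `G_n(u, g) = {a ∈ G | (a u⁻¹)^n = a^n = g}`. -/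
def nthRootSet {G : Type u} [Group G] (n : ℕ) (u g : G) : Set G :=
  {a : G | (a * u⁻¹) ^ n = a ^ n ∧ a ^ n = g}

/-!
The Sweedler power `Λ^[n]` is a central element of `D(G)` whose coefficient at `p_u ⊗ g` is
`|G_n(u, g)| / |G|`.

Since `Λ` is a cocommutative idempotent, it acts on `V^{⊗n}` by an idempotent commuting with the
cyclic rotation of the factors, and `χ_V(Λ^[n])` is the trace of the product of these two operators.
Hence indicators are algebraic integers, and they are integers as soon as they are rational.

For commuting `x` and `g`, the numbers `χ_V(p_x ⊗ g^j)` are the values at `ζ^j` of a single rational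
polynomial, where `ζ` is a primitive `|G|`-th root of unity. So `χ_V(Λ^[n])` is rational if and only
if it does not change under the linear maps `p_x ⊗ g ↦ p_x ⊗ g^j` with `j` prime to `|G|`. These
maps preserve the center of `D(G)`, and the irreducible characters separate central elements because
`D(G)` is semisimple. Rationality of all indicators is therefore the equality of the coefficients of
`Λ^[n]` at `p_u ⊗ g^j` and at `p_u ⊗ g`.
-/

section Trace

open Module Polynomial

variable {K V : Type*} [Field K] [AddCommGroup V] [Module K V] {f : End K V}

theorem exists_eq_pow_of_hasEigenvalue {N : ℕ} [NeZero N] {ζ μ : K} (hζ : IsPrimitiveRoot ζ N)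
    (hf : f ^ (N + 1) = f) (hμ : f.HasEigenvalue μ) (hμ0 : μ ≠ 0) : ∃ i : ℕ, μ = ζ ^ i := by
  obtain ⟨v, hv⟩ := hμ.exists_hasEigenvector
  have hpow : μ ^ N * μ = μ := by
    refine smul_left_injective K hv.2 (?_ : (μ ^ N * μ) • v = μ • v)
    rw [← pow_succ, ← hv.pow_apply, hf, hv.apply_eq_smul]
  obtain ⟨i, -, hi⟩ := hζ.eq_pow_of_pow_eq_one ((mul_eq_right₀ hμ0).mp hpow)
  exact ⟨i, hi.symm⟩

variable [IsAlgClosed K] [FiniteDimensional K V]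

theorem trace_pow_eq_sum_eigenvalues (hf : f.IsSemisimple) (j : ℕ) :
    LinearMap.trace K V (f ^ j) =
      ∑ μ : f.Eigenvalues, finrank K (f.eigenspace μ) • (μ : K) ^ j := by
  classical
  have hint : DirectSum.IsInternal fun μ : f.Eigenvalues => f.eigenspace μ :=
    DirectSum.isInternal_ne_bot_iff.mpr <|
      DirectSum.isInternal_submodule_of_iSupIndep_of_iSup_eq_top
        f.eigenspaces_iSupIndep hf.iSup_eigenspace_eq_top
  have hpow (μ : K) (v : V) (hv : v ∈ f.eigenspace μ) : (f ^ j) v = μ ^ j • v := by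
    induction j with
    | zero => simp
    | succ j ih =>
      rw [pow_succ, End.mul_apply, End.mem_eigenspace_iff.mp hv, map_smul, ih, smul_smul, pow_succ']
  have hmaps (μ : K) : Set.MapsTo (f ^ j) (f.eigenspace μ) (f.eigenspace μ) := fun v hv => by
    rw [SetLike.mem_coe, hpow μ v hv]
    exact Submodule.smul_mem _ _ hv
  rw [LinearMap.trace_eq_sum_trace_restrict hint fun μ => hmaps μ]
  refine Finset.sum_congr rfl fun μ _ => ?_
  have hscalar : (f ^ j).restrict (hmaps μ) = (μ : K) ^ j • LinearMap.id :=
    LinearMap.ext fun v => Subtype.ext (hpow μ v v.2)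
  rw [hscalar, map_smul, LinearMap.trace_id, smul_eq_mul, nsmul_eq_mul, mul_comm]

theorem exists_trace_pow_eq_aeval [CharZero K] {N : ℕ} [NeZero N] {ζ : K}
    (hζ : IsPrimitiveRoot ζ N) (hf : f ^ (N + 1) = f) :
    ∃ P : ℚ[X], ∀ j : ℕ, 0 < j → LinearMap.trace K V (f ^ j) = aeval (ζ ^ j) P := by
  have hsep : (X * (X ^ N - 1) : K[X]).Separable := by
    refine separable_X.mul ((X_pow_sub_one_separable_iff).mpr (NeZero.ne _)) ?_
    exact ⟨X ^ (N - 1), -1, by rw [pow_sub_one_mul (NeZero.ne N)]; ring⟩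
  have hss : f.IsSemisimple := by
    refine End.isSemisimple_of_squarefree_aeval_eq_zero hsep.squarefree ?_
    simp [mul_sub, ← pow_succ', hf]
  have hroot (μ : f.Eigenvalues) (hμ : (μ : K) ≠ 0) : ∃ i : ℕ, (μ : K) = ζ ^ i :=
    exists_eq_pow_of_hasEigenvalue hζ hf μ.2 hμ
  choose! i hi using hroot
  classical
  refine ⟨∑ μ : f.Eigenvalues, if (μ : K) = 0 then 0 else finrank K (f.eigenspace μ) • X ^ i μ,
    fun j hj => ?_⟩
  rw [trace_pow_eq_sum_eigenvalues hss, map_sum]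
  refine Finset.sum_congr rfl fun μ _ => ?_
  split_ifs with h
  · simp [h, hj.ne']
  · simp [hi μ h, pow_right_comm]

end Trace
section Cyclotomic

open Polynomial

variable {E : Type*} [Field E] [CharZero E] {N : ℕ} [NeZero N] {ζ : E}

theorem aeval_pow_eq_ratCast (hζ : IsPrimitiveRoot ζ N) {P : ℚ[X]} {q : ℚ}
    (hP : aeval ζ P = (q : E)) {j : ℕ} (hj : j.Coprime N) : aeval (ζ ^ j) P = (q : E) := by
  have hdvd : minpoly ℚ (ζ ^ j) ∣ P - C q := by
    rw [← cyclotomic_eq_minpoly_rat (hζ.pow_of_coprime j hj) (NeZero.pos N),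
      cyclotomic_eq_minpoly_rat hζ (NeZero.pos N)]
    exact minpoly.dvd ℚ ζ (by simp [hP])
  simpa [sub_eq_zero] using aeval_eq_zero_of_dvd_aeval_eq_zero hdvd (minpoly.aeval ℚ (ζ ^ j))

theorem exists_ratCast_of_forall_aeval_pow_eq (hζ : IsPrimitiveRoot ζ N) {P : ℚ[X]}
    (hP : ∀ j : ℕ, j.Coprime N → aeval (ζ ^ j) P = aeval ζ P) : ∃ q : ℚ, aeval ζ P = (q : E) := by
  set R := P %ₘ cyclotomic N ℚ
  have hR (j : ℕ) (hj : j.Coprime N) : aeval (ζ ^ j) R = aeval ζ P := by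
    rw [← hP j hj, aeval_modByMonic_eq_self_of_root]
    rw [cyclotomic_eq_minpoly_rat (hζ.pow_of_coprime j hj) (NeZero.pos N)]
    exact minpoly.aeval ℚ _
  have hdeg : (R.map (algebraMap ℚ E) - C (aeval ζ P)).degree < (primitiveRoots N E).card := by
    rw [hζ.card_primitiveRoots, ← degree_cyclotomic N ℚ]
    refine (degree_sub_le _ _).trans_lt (max_lt ?_ ?_)
    · rw [degree_map]
      exact degree_modByMonic_lt _ (cyclotomic.monic N ℚ)
    · exact degree_C_le.trans_lt (degree_cyclotomic_pos N ℚ (NeZero.pos N))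
  have hconst : R.map (algebraMap ℚ E) - C (aeval ζ P) = 0 := by
    refine eq_zero_of_degree_lt_of_eval_finset_eq_zero _ hdeg fun μ hμ => ?_
    obtain ⟨j, -, hj, rfl⟩ := hζ.isPrimitiveRoot_iff.mp (isPrimitiveRoot_of_mem_primitiveRoots hμ)
    simp [eval_map_algebraMap, hR j hj]
  refine ⟨R.coeff 0, ?_⟩
  simpa [eq_comm] using congr_arg (coeff · 0) (sub_eq_zero.mp hconst)

theorem exists_ratCast_aeval_iff (hζ : IsPrimitiveRoot ζ N) {P : ℚ[X]} :
    (∃ q : ℚ, aeval ζ P = (q : E)) ↔ ∀ j : ℕ, j.Coprime N → aeval (ζ ^ j) P = aeval ζ P :=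
  ⟨fun ⟨_, hq⟩ _ hj => (aeval_pow_eq_ratCast hζ hq hj).trans hq.symm,
    exists_ratCast_of_forall_aeval_pow_eq hζ⟩

theorem exists_intCast_iff_exists_ratCast {x : E} (hx : IsIntegral ℤ x) :
    (∃ z : ℤ, x = z) ↔ ∃ q : ℚ, x = q := by
  refine ⟨fun ⟨z, hz⟩ => ⟨z, by simp [hz]⟩, fun ⟨q, hq⟩ => ?_⟩
  subst hq
  obtain ⟨z, rfl⟩ := IsIntegrallyClosed.isIntegral_iff.mp
    ((isIntegral_algebraMap_iff (algebraMap ℚ E).injective).mp hx)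
  exact ⟨z, by simp⟩

end Cyclotomic
section Matrices

open Matrix

variable {ι : Type*} [Fintype ι] [DecidableEq ι]

theorem matrix_pow_succ_apply {R : Type*} [Semiring R] (M : Matrix ι ι R) (m : ℕ) (i j : ι) :
    (M ^ (m + 1)) i j = ∑ I : Fin m → ι, (List.ofFn fun k =>
      M (Fin.cons (α := fun _ => ι) i I k) (Fin.snoc (α := fun _ => ι) I j k)).prod := by
  induction m generalizing i with
  | zero => simp [Fin.snoc]
  | succ m ih =>
    rw [pow_succ', Matrix.mul_apply, ← (Fin.consEquiv fun _ => ι).sum_comp, Fintype.sum_prod_type]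
    refine Finset.sum_congr rfl fun l _ => ?_
    rw [ih, Finset.mul_sum]
    refine Finset.sum_congr rfl fun I _ => ?_
    have hsnoc : Fin.snoc (α := fun _ => ι) ((Fin.consEquiv fun _ => ι) (l, I)) j =
        Fin.cons (α := fun _ => ι) l (Fin.snoc (α := fun _ => ι) I j) :=
      (Fin.cons_snoc_eq_snoc_cons l I j).symm
    simp only [hsnoc, List.ofFn_succ (n := m + 1), List.prod_cons, Fin.cons_zero, Fin.cons_succ,
      Fin.consEquiv_apply]

theorem trace_matrix_pow {R : Type*} [Semiring R] (M : Matrix ι ι R) (n : ℕ) [NeZero n] :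
    (M ^ n).trace = ∑ I : Fin n → ι, (List.ofFn fun k => M (I k) (I (finRotate n k))).prod := by
  obtain ⟨m, rfl⟩ := Nat.exists_eq_succ_of_ne_zero (NeZero.ne n)
  rw [trace, ← (Fin.consEquiv fun _ => ι).sum_comp, Fintype.sum_prod_type]
  refine Finset.sum_congr rfl fun i _ => ?_
  simp only [diag_apply, matrix_pow_succ_apply, Fin.snoc_eq_cons_rotate, Fin.consEquiv_apply]

theorem isIntegral_of_mem_spectrum {K A : Type*} [Field K] [Ring A] [Algebra K A] {a : A} {μ : K}
    (ha : IsIntegral ℤ a) (hμ : μ ∈ spectrum K a) : IsIntegral ℤ μ := by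
  obtain ⟨p, hp, hpa⟩ := ha
  refine ⟨p, hp, ?_⟩
  have h : (p.map (algebraMap ℤ K)).eval μ ∈ spectrum K (0 : A) := by
    rw [← hpa, ← Polynomial.aeval_def, ← Polynomial.aeval_map_algebraMap K]
    exact spectrum.subset_polynomial_aeval a _ ⟨μ, hμ, rfl⟩
  rw [← Polynomial.eval_map]
  by_contra hne
  exact h (by simpa [spectrum.mem_resolventSet_iff] using (IsUnit.mk0 _ hne).map (algebraMap K A))

theorem isIntegral_trace {K : Type*} [Field K] [IsAlgClosed K] {A : Matrix ι ι K}
    (hA : IsIntegral ℤ A) : IsIntegral ℤ A.trace := by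
  rw [trace_eq_sum_roots_charpoly]
  exact IsIntegral.multiset_sum fun μ hμ => isIntegral_of_mem_spectrum hA
    (mem_spectrum_of_isRoot_charpoly (Polynomial.isRoot_of_mem_roots hμ))

theorem isIntegral_mul_of_isOfFinOrder {A : Type*} [Ring A] {e p : A} (he : IsIdempotentElem e)
    (hp : IsOfFinOrder p) (hep : Commute e p) : IsIntegral ℤ (e * p) := by
  obtain ⟨N, hN, hpN⟩ := isOfFinOrder_iff_pow_eq_one.mp hp
  have hmonic : (Polynomial.X ^ (N + 1) - Polynomial.X : Polynomial ℤ).Monic :=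
    Polynomial.monic_X_pow_sub (by rw [Polynomial.degree_X]; exact_mod_cast Nat.succ_lt_succ hN)
  refine ⟨_, hmonic, ?_⟩
  simp [hep.mul_pow, he.pow_succ_eq, pow_succ p, hpN]

end Matrices

section TensorPower

open Matrix WithConv

variable {R H : Type*} [CommRing R] [Ring H] [Bialgebra R H]

/-- The matrix coefficients of a matrix representation of a bialgebra `H`, as elements of the
convolution algebra of linear forms on `H`, in which Sweedler powers become ordinary powers. -/
def coeffMatrix {ι : Type*} [Fintype ι] [DecidableEq ι] (ρ : H →ₐ[R] Matrix ι ι R) :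
    Matrix ι ι (WithConv (H →ₗ[R] R)) :=
  Matrix.of fun i j => toConv (entryLinearMap R R i j ∘ₗ ρ.toLinearMap)

@[simp]
theorem coeffMatrix_apply {ι : Type*} [Fintype ι] [DecidableEq ι] (ρ : H →ₐ[R] Matrix ι ι R)
    (i j : ι) (h : H) : (coeffMatrix ρ i j).ofConv h = ρ h i j :=
  rfl

/-- The tensor product of two matrix representations of a bialgebra. -/
noncomputable def tensorRep {ι κ : Type*} [Fintype ι] [DecidableEq ι] [Fintype κ] [DecidableEq κ]
    (ρ : H →ₐ[R] Matrix ι ι R) (σ : H →ₐ[R] Matrix κ κ R) : H →ₐ[R] Matrix (ι × κ) (ι × κ) R :=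
  (kroneckerAlgEquiv ι κ R).toAlgHom.comp
    ((Algebra.TensorProduct.map ρ σ).comp (Bialgebra.comulAlgHom R H))

theorem coeffMatrix_tensorRep {ι κ : Type*} [Fintype ι] [DecidableEq ι] [Fintype κ] [DecidableEq κ]
    (ρ : H →ₐ[R] Matrix ι ι R) (σ : H →ₐ[R] Matrix κ κ R) (i j : ι × κ) :
    coeffMatrix (tensorRep ρ σ) i j = coeffMatrix ρ i.1 j.1 * coeffMatrix σ i.2 j.2 := by
  have h : entryLinearMap R R i j ∘ₗ (kroneckerAlgEquiv ι κ R).toLinearMap ∘ₗ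
      TensorProduct.map ρ.toLinearMap σ.toLinearMap = LinearMap.mul' R R ∘ₗ TensorProduct.map
        (coeffMatrix ρ i.1 j.1).ofConv (coeffMatrix σ i.2 j.2).ofConv := by
    ext a b
    simp
  ext a
  exact LinearMap.congr_fun h (Coalgebra.comul a)

variable {ι : Type*} [Fintype ι] [DecidableEq ι]

theorem coeffMatrix_pow_apply (ρ : H →ₐ[R] Matrix ι ι R) (n : ℕ) (i j : ι) (h : H) :
    (coeffMatrix ρ ^ n) i j h = ρ (sweedlerPow R H n h) i j := by
  induction n generalizing i j h with
  | zero =>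
    by_cases hij : i = j <;> simp [hij, sweedlerPow, algebraMap_matrix_apply]
  | succ n ih =>
    have hcoeff : ∑ l, LinearMap.mul' R R ∘ₗ TensorProduct.map ((coeffMatrix ρ ^ n) i l).ofConv
          (coeffMatrix ρ l j).ofConv = entryLinearMap R R i j ∘ₗ ρ.toLinearMap ∘ₗ
        LinearMap.mul' R H ∘ₗ TensorProduct.map (sweedlerPow R H n) LinearMap.id := by
      ext a b
      simp [Matrix.mul_apply, ih]
    simpa [pow_succ, Matrix.mul_apply, sweedlerPow] using
      LinearMap.congr_fun hcoeff (Coalgebra.comul h)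

/-- The `n`-th tensor power of a matrix representation of a bialgebra. -/
noncomputable def tensorPowRep (ρ : H →ₐ[R] Matrix ι ι R) :
    (n : ℕ) → H →ₐ[R] Matrix (Fin n → ι) (Fin n → ι) R
  | 0 => (Algebra.ofId R _).comp (Bialgebra.counitAlgHom R H)
  | n + 1 => (reindexAlgEquiv R R (Fin.consEquiv fun _ => ι)).toAlgHom.comp
      (tensorRep ρ (tensorPowRep ρ n))

theorem coeffMatrix_tensorPowRep (ρ : H →ₐ[R] Matrix ι ι R) (n : ℕ) (I J : Fin n → ι) :
    coeffMatrix (tensorPowRep ρ n) I J =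
      (List.ofFn fun k => coeffMatrix ρ (I k) (J k)).prod := by
  induction n with
  | zero =>
    ext h
    simp [tensorPowRep, Subsingleton.elim I J, Algebra.ofId_apply, algebraMap_matrix_apply]
  | succ n ih =>
    rw [List.ofFn_succ, List.prod_cons, ← ih]
    exact coeffMatrix_tensorRep ρ _ (I 0, I ∘ Fin.succ) (J 0, J ∘ Fin.succ)

theorem conv_mul_comm_apply {Λ : H}
    (hΛ : TensorProduct.comm R H H (Coalgebra.comul Λ) = Coalgebra.comul Λ)
    (φ ψ : WithConv (H →ₗ[R] R)) : (φ * ψ) Λ = (ψ * φ) Λ := by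
  have hcomm : LinearMap.mul' R R ∘ₗ TensorProduct.map φ.ofConv ψ.ofConv =
      LinearMap.mul' R R ∘ₗ TensorProduct.map ψ.ofConv φ.ofConv ∘ₗ
        (TensorProduct.comm R H H).toLinearMap := by
    ext a b
    simp [mul_comm]
  simpa [hΛ] using LinearMap.congr_fun hcomm (Coalgebra.comul Λ)

theorem prod_ofFn_comp_finRotate_apply {Λ : H}
    (hΛ : TensorProduct.comm R H H (Coalgebra.comul Λ) = Coalgebra.comul Λ) {n : ℕ}
    (φ : Fin n → WithConv (H →ₗ[R] R)) :
    (List.ofFn (φ ∘ finRotate n)).prod Λ = (List.ofFn φ).prod Λ := by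
  cases n with
  | zero => rfl
  | succ n =>
    rw [List.ofFn_succ_last, List.ofFn_succ, List.prod_append, List.prod_singleton, List.prod_cons,
      conv_mul_comm_apply hΛ]
    simp [finRotate_apply]

/-- The matrix permuting the factors of the `n`-fold tensor power cyclically. -/
def rotationMatrix (R ι : Type*) [CommRing R] [Fintype ι] [DecidableEq ι] (n : ℕ) :
    Matrix (Fin n → ι) (Fin n → ι) R :=
  Equiv.Perm.permMatrix R ((finRotate n).arrowCongr (Equiv.refl ι))

theorem isOfFinOrder_rotationMatrix (n : ℕ) : IsOfFinOrder (rotationMatrix R ι n) := by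
  let σ : Equiv.Perm (Fin n → ι) := (finRotate n).arrowCongr (Equiv.refl ι)
  have h := (permMatrixHom (n := Fin n → ι) (R := R)).isOfFinOrder (isOfFinOrder_of_finite σ⁻¹)
  simpa [rotationMatrix, σ] using h

theorem mul_rotationMatrix_apply (n : ℕ) (M : Matrix (Fin n → ι) (Fin n → ι) R)
    (I J : Fin n → ι) : (M * rotationMatrix R ι n) I J = M I (J ∘ finRotate n) := by
  rw [rotationMatrix, PEquiv.mul_toMatrix_toPEquiv]
  rfl

theorem rotationMatrix_mul_apply (n : ℕ) (M : Matrix (Fin n → ι) (Fin n → ι) R)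
    (I J : Fin n → ι) : (rotationMatrix R ι n * M) I J = M (I ∘ (finRotate n).symm) J := by
  rw [rotationMatrix, PEquiv.toMatrix_toPEquiv_mul]
  rfl

theorem commute_tensorPowRep_rotationMatrix {Λ : H}
    (hΛ : TensorProduct.comm R H H (Coalgebra.comul Λ) = Coalgebra.comul Λ)
    (ρ : H →ₐ[R] Matrix ι ι R) (n : ℕ) :
    Commute (tensorPowRep ρ n Λ) (rotationMatrix R ι n) := by
  ext I J
  rw [mul_rotationMatrix_apply, rotationMatrix_mul_apply, ← coeffMatrix_apply, ← coeffMatrix_apply,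
    coeffMatrix_tensorPowRep, coeffMatrix_tensorPowRep]
  refine Eq.trans ?_ (prod_ofFn_comp_finRotate_apply hΛ _)
  simp only [Function.comp_def, Equiv.symm_apply_apply]

theorem trace_tensorPowRep_mul_rotationMatrix (ρ : H →ₐ[R] Matrix ι ι R) (n : ℕ) [NeZero n]
    (h : H) : (tensorPowRep ρ n h * rotationMatrix R ι n).trace =
      (ρ (sweedlerPow R H n h)).trace := by
  have htrace := congr_arg (fun φ => φ.ofConv h) (trace_matrix_pow (coeffMatrix ρ) n)
  simp only [trace, diag_apply, ofConv_sum, LinearMap.sum_apply, coeffMatrix_pow_apply] at htrace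
  simp only [trace, diag_apply, htrace]
  simp only [mul_rotationMatrix_apply, ← coeffMatrix_apply, coeffMatrix_tensorPowRep,
    Function.comp_apply]

end TensorPower

theorem isIntegral_fsIndicator {K H : Type*} [Field K] [IsAlgClosed K] [Ring H] [Bialgebra K H]
    {Λ : H} (hΛ : IsIdempotentElem Λ)
    (hcomm : TensorProduct.comm K H H (Coalgebra.comul Λ) = Coalgebra.comul Λ) (n : ℕ) [NeZero n]
    (V : Type*) [AddCommGroup V] [Module K V] [FiniteDimensional K V] [Module H V]
    [IsScalarTower K H V] : IsIntegral ℤ (fsIndicator K Λ n V) := by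
  let b := Module.finBasis K V
  let ρ : H →ₐ[K] Matrix _ _ K :=
    (LinearMap.toMatrixAlgEquiv b).toAlgHom.comp (Algebra.lsmul K K V)
  have htrace : fsIndicator K Λ n V = (ρ (sweedlerPow K H n Λ)).trace :=
    LinearMap.trace_eq_matrix_trace K b _
  rw [htrace, ← trace_tensorPowRep_mul_rotationMatrix]
  exact isIntegral_trace <| isIntegral_mul_of_isOfFinOrder (hΛ.map (tensorPowRep ρ n))
    (isOfFinOrder_rotationMatrix n) (commute_tensorPowRep_rotationMatrix hcomm ρ n)

section Radical

variable {K : Type*} {A : Type u} [Field K] [Ring A] [Algebra K A] {z : A}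

theorem trace_mulLeft_eq_zero_of_mem_jacobson [FiniteDimensional K A] (hz : z ∈ Ring.jacobson A) :
    LinearMap.trace K A (LinearMap.mulLeft K z) = 0 := by
  have : IsArtinianRing A := .of_finite K A
  obtain ⟨m, hm⟩ := IsSemiprimaryRing.isNilpotent (R := A)
  have hzm : z ^ m = 0 := by simpa [hm] using Ideal.pow_mem_pow hz m
  have hnil : IsNilpotent (LinearMap.mulLeft K z) := ⟨m, by simp [LinearMap.pow_mulLeft, hzm]⟩
  exact (LinearMap.isNilpotent_trace_of_isNilpotent hnil).eq_zero

variable [IsAlgClosed K]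

theorem exists_forall_smul_eq_smul_of_mem_center (hz : z ∈ Subalgebra.center K A) (V : Type*)
    [AddCommGroup V] [Module K V] [Module A V] [IsScalarTower K A V] [FiniteDimensional K V]
    [IsSimpleModule A V] : ∃ c : K, ∀ v : V, z • v = c • v := by
  obtain ⟨c, hc⟩ := (IsSimpleModule.algebraMap_end_bijective_of_isAlgClosed K).surjective
    (Module.End.smulLeft (M := V) z hz)
  exact ⟨c, fun v => (LinearMap.congr_fun hc v).symm⟩

theorem smul_eq_zero_of_moduleCharacter_eq_zero [CharZero K] (hz : z ∈ Subalgebra.center K A)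
    {V : Type*} [AddCommGroup V] [Module K V] [Module A V] [IsScalarTower K A V]
    [FiniteDimensional K V] [IsSimpleModule A V] (hV : moduleCharacter K A V z = 0) (v : V) :
    z • v = 0 := by
  obtain ⟨c, hc⟩ := exists_forall_smul_eq_smul_of_mem_center hz V
  have hlsmul : Algebra.lsmul K K V z = c • LinearMap.id := LinearMap.ext hc
  have : Nontrivial V := IsSimpleModule.nontrivial A V
  have hc0 : c = 0 := by
    simpa [moduleCharacter, hlsmul, Module.finrank_pos.ne'] using hV
  rw [hc, hc0, zero_smul]

theorem mem_jacobson_of_forall_moduleCharacter_eq_zero [CharZero K] [FiniteDimensional K A]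
    (hz : z ∈ Subalgebra.center K A)
    (hchar : ∀ (V : Type u) [AddCommGroup V] [Module K V] [Module A V] [IsScalarTower K A V]
      [FiniteDimensional K V] [IsSimpleModule A V], moduleCharacter K A V z = 0) :
    z ∈ Ring.jacobson A := by
  rw [Ring.jacobson_eq_sInf_isMaximal, Ideal.mem_sInf]
  intro I hI
  have : IsSimpleModule A (A ⧸ I) := isSimpleModule_iff_isCoatom.mpr (Ideal.isMaximal_def.mp hI)
  have : FiniteDimensional K (A ⧸ I) :=
    Module.Finite.of_surjective (I.mkQ.restrictScalars K) I.mkQ_surjective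
  have h := smul_eq_zero_of_moduleCharacter_eq_zero hz (hchar (A ⧸ I)) (I.mkQ 1)
  rwa [← map_smul, smul_eq_mul, mul_one, Submodule.mkQ_apply, Submodule.Quotient.mk_eq_zero] at h

end Radical

namespace IsNormalizedIntegral

variable {R H : Type*} [CommRing R] [Ring H] [Bialgebra R H] {Λ : H}

theorem isIdempotentElem (hΛ : IsNormalizedIntegral R Λ) : IsIdempotentElem Λ := by
  rw [IsIdempotentElem, hΛ.left, hΛ.counit_eq_one, one_smul]

end IsNormalizedIntegral

theorem inv_mul_mul_eq_self_iff_commute {G : Type*} [Group G] {x g : G} :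
    g⁻¹ * x * g = x ↔ Commute x g := by
  rw [mul_assoc, inv_mul_eq_iff_eq_mul]
  rfl

namespace DrinfeldDouble

theorem coeff_apply {G : Type u} (x g : G) (f : DrinfeldDouble G) : coeff x g f = f x g :=
  rfl

instance {G : Type u} [Finite G] : FiniteDimensional ℂ (DrinfeldDouble G) :=
  inferInstanceAs (FiniteDimensional ℂ (G → G → ℂ))

variable {G : Type u} [Group G] [Fintype G] [DecidableEq G]

theorem single_mul_apply (y h : G) (f : DrinfeldDouble G) (x g : G) :
    (single y h * f) x g = if x = y then f (h⁻¹ * x * h) (h⁻¹ * g) else 0 := by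
  simp [mul_apply, single_apply, ite_and]

theorem mul_single_apply (f : DrinfeldDouble G) (y h x g : G) :
    (f * single y h) x g =
      if (g * h⁻¹)⁻¹ * x * (g * h⁻¹) = y then f x (g * h⁻¹) else 0 := by
  rw [mul_apply, Finset.sum_eq_single (g * h⁻¹)]
  · simp [single_apply]
  · intro k _ hk
    have hkg : k⁻¹ * g ≠ h := fun h => hk (by rw [← h]; group)
    simp [single_apply, hkg]
  · simp

theorem apply_eq_zero_of_mem_center {f : DrinfeldDouble G}
    (hf : f ∈ Subalgebra.center ℂ (DrinfeldDouble G)) {x g : G} (hxg : ¬ Commute x g) :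
    f x g = 0 := by
  have h := congr_fun₂ (Subalgebra.mem_center_iff.mp hf (single x 1)) x g
  simpa [single_mul_apply, mul_single_apply, inv_mul_mul_eq_self_iff_commute, hxg] using h

theorem apply_conj_of_mem_center {f : DrinfeldDouble G}
    (hf : f ∈ Subalgebra.center ℂ (DrinfeldDouble G)) (h x g : G) :
    f (h * x * h⁻¹) (h * g * h⁻¹) = f x g := by
  have hcomm : Commute (h * x * h⁻¹) (h * g * h⁻¹) ↔ Commute x g := Commute.conj_iff h
  by_cases hxg : Commute x g
  · have hsingle := congr_fun₂
      (Subalgebra.mem_center_iff.mp hf (single (h * x * h⁻¹) h)) (h * x * h⁻¹) (h * g)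
    rw [single_mul_apply, mul_single_apply, if_pos rfl,
      if_pos (inv_mul_mul_eq_self_iff_commute.mpr (hcomm.mpr hxg))] at hsingle
    simpa [mul_assoc] using hsingle.symm
  · rw [apply_eq_zero_of_mem_center hf hxg, apply_eq_zero_of_mem_center hf (mt hcomm.mp hxg)]

theorem mem_center_of_apply_conj {f : DrinfeldDouble G}
    (hconj : ∀ h x g, f (h * x * h⁻¹) (h * g * h⁻¹) = f x g)
    (hsupp : ∀ x g, ¬ Commute x g → f x g = 0) : f ∈ Subalgebra.center ℂ (DrinfeldDouble G) := by
  have hmul : LinearMap.mulRight ℂ f = LinearMap.mulLeft ℂ f := by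
    refine linearMap_ext fun y h => ext fun x g => ?_
    have hf : f (h⁻¹ * x * h) (h⁻¹ * g) = f x (g * h⁻¹) := by
      simpa [mul_assoc] using hconj h⁻¹ x (g * h⁻¹)
    rw [LinearMap.mulRight_apply, LinearMap.mulLeft_apply, single_mul_apply, mul_single_apply, hf]
    by_cases hxg : Commute x (g * h⁻¹)
    · rw [inv_mul_mul_eq_self_iff_commute.mpr hxg]
    · simp [hsupp _ _ hxg]
  exact Subalgebra.mem_center_iff.mpr fun w => LinearMap.congr_fun hmul w

theorem trace_eq_sum (φ : Module.End ℂ (DrinfeldDouble G)) :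
    LinearMap.trace ℂ _ φ = ∑ x, ∑ g, φ (single x g) x g := by
  have hφ : φ = ∑ x, ∑ g, (coeff x g).smulRight (φ (single x g)) :=
    linearMap_ext fun x g => by
      simp [coeff_apply, single_apply, ite_and]
  conv_lhs => rw [hφ]
  simp only [map_sum, LinearMap.trace_smulRight]
  rfl

theorem trace_mulLeft (f : DrinfeldDouble G) :
    LinearMap.trace ℂ _ (LinearMap.mulLeft ℂ f) = Fintype.card G * ∑ x, f x 1 := by
  simp [trace_eq_sum, mul_single_apply, Finset.mul_sum]

theorem jacobson_eq_bot : Ring.jacobson (DrinfeldDouble G) = ⊥ := by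
  refine (Submodule.eq_bot_iff _).mpr fun z hz => ext fun x g => ?_
  have htrace := trace_mulLeft_eq_zero_of_mem_jacobson (K := ℂ)
    (Ideal.mul_mem_left _ (single (g⁻¹ * x * g) g⁻¹) hz)
  simpa [-LinearMap.mulLeft_mul, trace_mulLeft, single_mul_apply, mul_assoc] using htrace

theorem eq_zero_of_forall_moduleCharacter_eq_zero {z : DrinfeldDouble G}
    (hz : z ∈ Subalgebra.center ℂ (DrinfeldDouble G))
    (hchar : ∀ (V : Type u) [AddCommGroup V] [Module ℂ V] [Module (DrinfeldDouble G) V]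
      [IsScalarTower ℂ (DrinfeldDouble G) V] [FiniteDimensional ℂ V]
      [IsSimpleModule (DrinfeldDouble G) V], moduleCharacter ℂ (DrinfeldDouble G) V z = 0) :
    z = 0 := by
  simpa [jacobson_eq_bot] using mem_jacobson_of_forall_moduleCharacter_eq_zero hz hchar

end DrinfeldDouble

section PowMap

variable {G : Type*} [Group G]

theorem pow_injective_of_coprime {j : ℕ} (hj : j.Coprime (Nat.card G)) :
    Function.Injective fun g : G => g ^ j :=
  (powCoprime hj.symm).injective

theorem commute_pow_right_iff_of_coprime {j : ℕ} (hj : j.Coprime (Nat.card G))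
    {x g : G} : Commute x (g ^ j) ↔ Commute x g := by
  refine ⟨fun h => ?_, fun h => h.pow_right j⟩
  obtain ⟨i, hi⟩ := exists_pow_eq_self_of_coprime (hj.coprime_dvd_right (orderOf_dvd_natCard g))
  exact hi ▸ h.pow_right i

end PowMap

namespace DrinfeldDouble

variable {G : Type u} [Group G] [Fintype G] [DecidableEq G]

theorem single_pow {x g : G} (hxg : Commute x g) {j : ℕ} (hj : j ≠ 0) :
    single x g ^ j = single x (g ^ j) := by
  induction j, Nat.one_le_iff_ne_zero.mpr hj using Nat.le_induction with
  | base => simp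
  | succ j hj' ih =>
    have hconj : x = g ^ j * x * (g ^ j)⁻¹ := eq_mul_inv_of_mul_eq (hxg.pow_right j)
    rw [pow_succ, ih (Nat.one_le_iff_ne_zero.mp hj'), single_mul_single, if_pos hconj, ← pow_succ]

/-- The linear map `p_x ⊗ g ↦ p_x ⊗ g ^ j`. For `j` prime to `|G|` it realizes, on characters at
elements with rational coefficients, the Galois automorphism raising roots of unity to the `j`-th
power. -/
noncomputable def powMap (j : ℕ) : DrinfeldDouble G →ₗ[ℂ] DrinfeldDouble G :=
  ∑ x, ∑ g, (coeff x g).smulRight (single x (g ^ j))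

theorem powMap_apply (j : ℕ) (f : DrinfeldDouble G) :
    powMap j f = ∑ x, ∑ g, f x g • single x (g ^ j) := by
  simp [powMap, coeff_apply]

theorem powMap_one (f : DrinfeldDouble G) : powMap 1 f = f := by
  simpa [powMap_apply] using (eq_sum_single f).symm

theorem powMap_apply_pow {j : ℕ} (hj : j.Coprime (Nat.card G)) (f : DrinfeldDouble G) (x g : G) :
    powMap j f x (g ^ j) = f x g := by
  have hpow (k : G) : g ^ j = k ^ j ↔ g = k := (pow_injective_of_coprime hj).eq_iff
  simp [powMap_apply, sum_apply, single_apply, hpow, ite_and]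

theorem powMap_eq_self_iff {j : ℕ} (hj : j.Coprime (Nat.card G)) {f : DrinfeldDouble G} :
    powMap j f = f ↔ ∀ x g, f x (g ^ j) = f x g := by
  refine ⟨fun h x g => ?_, fun h => ext fun x g => ?_⟩
  · exact (congr_fun₂ h x (g ^ j)).symm.trans (powMap_apply_pow hj f x g)
  · obtain ⟨k, rfl⟩ := (powCoprime hj.symm).surjective g
    exact (powMap_apply_pow hj f x k).trans (h x k).symm

theorem powMap_mem_center {j : ℕ} (hj : j.Coprime (Nat.card G)) {f : DrinfeldDouble G}
    (hf : f ∈ Subalgebra.center ℂ (DrinfeldDouble G)) :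
    powMap j f ∈ Subalgebra.center ℂ (DrinfeldDouble G) := by
  refine mem_center_of_apply_conj (fun h x g => ?_) (fun x g hxg => ?_) <;>
    obtain ⟨k, rfl : k ^ j = g⟩ := (powCoprime hj.symm).surjective g
  · rw [← conj_pow, powMap_apply_pow hj, powMap_apply_pow hj, apply_conj_of_mem_center hf]
  · rw [commute_pow_right_iff_of_coprime hj] at hxg
    rw [powMap_apply_pow hj, apply_eq_zero_of_mem_center hf hxg]

section Character

open Polynomial

variable {V : Type*} [AddCommGroup V] [Module ℂ V] [Module (DrinfeldDouble G) V]
  [IsScalarTower ℂ (DrinfeldDouble G) V] [FiniteDimensional ℂ V] {ζ : ℂ}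

theorem exists_moduleCharacter_single_pow_eq_aeval (hζ : IsPrimitiveRoot ζ (Nat.card G)) {x g : G}
    (hxg : Commute x g) :
    ∃ P : ℚ[X], ∀ j, moduleCharacter ℂ (DrinfeldDouble G) V (single x (g ^ j)) =
      aeval (ζ ^ j) P := by
  have hpow : Algebra.lsmul ℂ ℂ V (single x g) ^ (Nat.card G + 1) =
      Algebra.lsmul ℂ ℂ V (single x g) := by
    rw [← map_pow, single_pow hxg (Nat.succ_ne_zero _), pow_succ, pow_card_eq_one', one_mul]
  obtain ⟨P, hP⟩ := exists_trace_pow_eq_aeval hζ hpow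
  refine ⟨P, fun j => ?_⟩
  have hj : 0 < j + Nat.card G := Nat.add_pos_right j Nat.card_pos
  have h := hP (j + Nat.card G) hj
  rwa [← map_pow, single_pow hxg hj.ne', pow_add, pow_card_eq_one', mul_one, pow_add, hζ.pow_eq_one,
    mul_one] at h

theorem exists_moduleCharacter_powMap_eq_aeval (hζ : IsPrimitiveRoot ζ (Nat.card G))
    {f : DrinfeldDouble G} (hf : f ∈ Subalgebra.center ℂ (DrinfeldDouble G))
    (hrat : ∀ x g, ∃ q : ℚ, f x g = q) :
    ∃ P : ℚ[X], ∀ j, moduleCharacter ℂ (DrinfeldDouble G) V (powMap j f) = aeval (ζ ^ j) P := by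
  have hterm (x g : G) : ∃ P : ℚ[X], ∀ j,
      f x g * moduleCharacter ℂ (DrinfeldDouble G) V (single x (g ^ j)) = aeval (ζ ^ j) P := by
    by_cases hxg : Commute x g
    · obtain ⟨q, hq⟩ := hrat x g
      obtain ⟨P, hP⟩ := exists_moduleCharacter_single_pow_eq_aeval (V := V) hζ hxg
      exact ⟨C q * P, fun j => by simp [hq, hP]⟩
    · exact ⟨0, by simp [apply_eq_zero_of_mem_center hf hxg]⟩
  choose P hP using hterm
  exact ⟨∑ x, ∑ g, P x g, fun j => by simp [powMap_apply, hP]⟩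

theorem exists_ratCast_moduleCharacter_iff {f : DrinfeldDouble G}
    (hf : f ∈ Subalgebra.center ℂ (DrinfeldDouble G)) (hrat : ∀ x g, ∃ q : ℚ, f x g = q) :
    (∃ q : ℚ, moduleCharacter ℂ (DrinfeldDouble G) V f = q) ↔ ∀ j : ℕ, j.Coprime (Nat.card G) →
      moduleCharacter ℂ (DrinfeldDouble G) V (powMap j f) =
        moduleCharacter ℂ (DrinfeldDouble G) V f := by
  obtain ⟨ζ, hζ⟩ : ∃ ζ : ℂ, IsPrimitiveRoot ζ (Nat.card G) :=
    ⟨_, Complex.isPrimitiveRoot_exp _ Nat.card_pos.ne'⟩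
  obtain ⟨P, hP⟩ := exists_moduleCharacter_powMap_eq_aeval (V := V) hζ hf hrat
  have hP1 : moduleCharacter ℂ (DrinfeldDouble G) V f = aeval ζ P := by
    simpa [powMap_one] using hP 1
  simp only [hP, hP1, exists_ratCast_aeval_iff hζ]

end Character

theorem forall_exists_ratCast_moduleCharacter_iff {f : DrinfeldDouble G}
    (hf : f ∈ Subalgebra.center ℂ (DrinfeldDouble G)) (hrat : ∀ x g, ∃ q : ℚ, f x g = q) :
    (∀ (V : Type u) [AddCommGroup V] [Module ℂ V] [Module (DrinfeldDouble G) V]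
      [IsScalarTower ℂ (DrinfeldDouble G) V] [FiniteDimensional ℂ V]
      [IsSimpleModule (DrinfeldDouble G) V],
      ∃ q : ℚ, moduleCharacter ℂ (DrinfeldDouble G) V f = q) ↔
    ∀ j : ℕ, j.Coprime (Nat.card G) → ∀ x g, f x (g ^ j) = f x g := by
  refine ⟨fun h j hj => (powMap_eq_self_iff hj).mp ?_, fun h V _ _ _ _ _ _ => ?_⟩
  · refine sub_eq_zero.mp (eq_zero_of_forall_moduleCharacter_eq_zero
      (sub_mem (powMap_mem_center hj hf) hf) fun V _ _ _ _ _ _ => ?_)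
    rw [map_sub, (exists_ratCast_moduleCharacter_iff hf hrat).mp (h V) j hj, sub_self]
  · exact (exists_ratCast_moduleCharacter_iff hf hrat).mpr fun j hj => by
      rw [(powMap_eq_self_iff hj).mpr (h j hj)]

end DrinfeldDouble

section RootSets

variable {G : Type*} [Group G]

theorem mem_nthRootSet_iff_mul_pow_eq_one {n : ℕ} {u k a : G} :
    a ∈ nthRootSet n u k ↔ (u * a⁻¹) ^ n * a ^ n = 1 ∧ k = a ^ n := by
  have hinv : u * a⁻¹ = (a * u⁻¹)⁻¹ := by group
  rw [hinv, inv_pow, inv_mul_eq_one, nthRootSet, Set.mem_ofPred_eq, eq_comm (b := k)]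

theorem nthRootSet_eq_empty_of_not_commute {n : ℕ} {u g : G} (h : ¬ Commute u g) :
    nthRootSet n u g = ∅ := by
  refine Set.eq_empty_iff_forall_notMem.mpr fun a ⟨hau, ha⟩ => h ?_
  have ha_comm : Commute a g := ha ▸ Commute.self_pow a n
  have hau_comm : Commute (a * u⁻¹) g := (hau.trans ha) ▸ Commute.self_pow (a * u⁻¹) n
  simpa using ha_comm.inv_left.mul_left hau_comm

theorem nthRootSet_conj (n : ℕ) (h u g : G) :
    nthRootSet n (h * u * h⁻¹) (h * g * h⁻¹) = MulAut.conj h '' nthRootSet n u g := by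
  ext a
  obtain ⟨b, rfl⟩ := (MulAut.conj h).surjective a
  rw [(MulAut.conj h).injective.mem_set_image]
  simp only [nthRootSet, Set.mem_ofPred_eq, ← MulAut.conj_apply, ← map_inv, ← map_mul, ← map_pow,
    (MulAut.conj h).injective.eq_iff]

theorem ncard_nthRootSet_conj (n : ℕ) (h u g : G) :
    (nthRootSet n (h * u * h⁻¹) (h * g * h⁻¹)).ncard = (nthRootSet n u g).ncard := by
  rw [nthRootSet_conj, Set.ncard_image_of_injective _ (MulAut.conj h).injective]

end RootSets

namespace DrinfeldDouble

variable {G : Type u} [Group G] [Fintype G] [DecidableEq G]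

theorem sweedlerPow_zero_single (x g : G) :
    sweedlerPow ℂ (DrinfeldDouble G) 0 (single x g) = if x = 1 then 1 else 0 := by
  by_cases hx : x = 1 <;> simp [sweedlerPow, counit_single, hx]

theorem sweedlerPow_succ_single (n : ℕ) (x g : G) :
    sweedlerPow ℂ (DrinfeldDouble G) (n + 1) (single x g) =
      ∑ a, sweedlerPow ℂ (DrinfeldDouble G) n (single a g) * single (a⁻¹ * x) g := by
  simp [sweedlerPow, comul_single]

theorem sweedlerPow_single (n : ℕ) (x g : G) :
    sweedlerPow ℂ (DrinfeldDouble G) n (single x g) =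
      ∑ a, if (a * g⁻¹) ^ n * g ^ n = x then single a (g ^ n) else 0 := by
  induction n generalizing x with
  | zero =>
    by_cases hx : x = 1
    · simp [sweedlerPow_zero_single, one_eq_sum, hx]
    · simp [sweedlerPow_zero_single, hx, Ne.symm hx]
  | succ n ih =>
    simp only [sweedlerPow_succ_single, ih, Finset.sum_mul, ite_mul, zero_mul]
    rw [Finset.sum_comm]
    refine Finset.sum_congr rfl fun a _ => ?_
    rw [Finset.sum_ite_eq, if_pos (Finset.mem_univ _), single_mul_single, ← pow_succ]
    have hcancel : g ^ n * (((a * g⁻¹) ^ n * g ^ n)⁻¹ * x) * (g ^ n)⁻¹ =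
        ((a * g⁻¹) ^ n)⁻¹ * x * (g ^ n)⁻¹ := by group
    have hpow : (a * g⁻¹) ^ (n + 1) * g ^ (n + 1) = (a * g⁻¹) ^ n * (a * g ^ n) := by
      rw [pow_succ, pow_succ']
      group
    congr 1
    rw [hcancel, eq_mul_inv_iff_mul_eq, eq_inv_mul_iff_mul_eq, hpow]

theorem sweedlerPow_integral_apply (n : ℕ) (u g : G) :
    sweedlerPow ℂ (DrinfeldDouble G) n (integral G) u g =
      (Fintype.card G : ℂ)⁻¹ * (nthRootSet n u g).ncard := by
  classical
  have hsingle (a : G) : sweedlerPow ℂ (DrinfeldDouble G) n (single 1 a) u g =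
      if a ∈ nthRootSet n u g then 1 else 0 := by
    simp only [sweedlerPow_single, sum_apply, apply_ite (fun f : DrinfeldDouble G => f u g),
      single_apply, zero_apply, mem_nthRootSet_iff_mul_pow_eq_one]
    rw [Finset.sum_eq_single u (fun b _ hb => by simp [hb.symm]) (by simp)]
    simp [ite_and]
  rw [integral, map_smul, map_sum, smul_apply, sum_apply, Finset.sum_congr rfl fun a _ => hsingle a,
    Finset.sum_boole, Set.ncard_eq_toFinset_card', Set.filter_mem_univ_eq_toFinset]

theorem sweedlerPow_integral_mem_center (n : ℕ) :
    sweedlerPow ℂ _ n (integral G) ∈ Subalgebra.center ℂ (DrinfeldDouble G) := by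
  refine mem_center_of_apply_conj (fun h x g => ?_) fun x g hxg => ?_
  · rw [sweedlerPow_integral_apply, sweedlerPow_integral_apply, ncard_nthRootSet_conj]
  · simp [sweedlerPow_integral_apply, nthRootSet_eq_empty_of_not_commute hxg]

theorem comm_comul_integral :
    TensorProduct.comm ℂ _ _ (Coalgebra.comul (integral G)) = Coalgebra.comul (integral G) := by
  have hsingle (g : G) : TensorProduct.comm ℂ _ _ (Coalgebra.comul (single 1 g)) =
      Coalgebra.comul (R := ℂ) (single 1 g) := by
    simp only [comul_single, map_sum, TensorProduct.comm_tmul]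
    exact Fintype.sum_equiv (Equiv.inv G) _ _ fun a => by simp
  simp only [integral, map_smul, map_sum, hsingle]

theorem isIntegral_fsIndicator_integral (n : ℕ) [NeZero n] (V : Type*) [AddCommGroup V] [Module ℂ V]
    [Module (DrinfeldDouble G) V] [IsScalarTower ℂ (DrinfeldDouble G) V] [FiniteDimensional ℂ V] :
    IsIntegral ℤ (fsIndicator ℂ (integral G) n V) :=
  isIntegral_fsIndicator isNormalizedIntegral_integral.isIdempotentElem comm_comul_integral n V

theorem isFSZ_iff_forall_coprime_pow (n : ℕ) [NeZero n] :
    IsFSZ G n ↔ ∀ j : ℕ, j.Coprime (Nat.card G) → ∀ u g : G,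
      (nthRootSet n u (g ^ j)).ncard = (nthRootSet n u g).ncard := by
  have hrat (x g : G) : ∃ q : ℚ, sweedlerPow ℂ (DrinfeldDouble G) n (integral G) x g = q :=
    ⟨(Fintype.card G : ℚ)⁻¹ * (nthRootSet n x g).ncard, by simp [sweedlerPow_integral_apply]⟩
  have hint (V : Type u) [AddCommGroup V] [Module ℂ V] [Module (DrinfeldDouble G) V]
      [IsScalarTower ℂ (DrinfeldDouble G) V] [FiniteDimensional ℂ V] :=
    exists_intCast_iff_exists_ratCast (isIntegral_fsIndicator_integral (G := G) n V)
  refine (Iff.trans ?_ (forall_exists_ratCast_moduleCharacter_iff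
    (sweedlerPow_integral_mem_center n) hrat)).trans ?_
  · exact ⟨fun h V _ _ _ _ _ _ => (hint V).mp (h V), fun h V _ _ _ _ _ _ => (hint V).mpr (h V)⟩
  · simp [sweedlerPow_integral_apply]

end DrinfeldDouble

theorem exists_coprime_forall_zpow_eq_pow {G : Type*} [Group G] [Finite G] {m : ℤ}
    (hm : Int.gcd m (Nat.card G) = 1) :
    ∃ j : ℕ, j.Coprime (Nat.card G) ∧ ∀ g : G, g ^ m = g ^ j := by
  have hcard : (Nat.card G : ℤ) ≠ 0 := by exact_mod_cast Nat.card_pos.ne'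
  obtain ⟨j, hj⟩ := Int.eq_ofNat_of_zero_le (Int.emod_nonneg m hcard)
  refine ⟨j, by rwa [← Int.gcd_emod, hj] at hm, fun g => ?_⟩
  rw [← zpow_natCast, ← hj, zpow_mod_natCard]

theorem mainTheorem2 {G : Type*} [Group G] [Fintype G] [DecidableEq G] (n : ℕ) (hn : 0 < n) :
    IsFSZ G n ↔
      ∀ u g : G, Commute u g → ∀ m : ℤ, Int.gcd m (Fintype.card G) = 1 →
        (nthRootSet n u g).ncard = (nthRootSet n u (g ^ m)).ncard := by
  have : NeZero n := ⟨hn.ne'⟩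
  rw [DrinfeldDouble.isFSZ_iff_forall_coprime_pow, ← Nat.card_eq_fintype_card]
  refine ⟨fun h u g _ m hm => ?_, fun h j hj u g => ?_⟩
  · obtain ⟨j, hj, hmj⟩ := exists_coprime_forall_zpow_eq_pow hm
    rw [hmj, h j hj]
  · by_cases hug : Commute u g
    · simpa using (h u g hug j (by simpa using hj)).symm
    · rw [nthRootSet_eq_empty_of_not_commute hug, nthRootSet_eq_empty_of_not_commute
        (mt (commute_pow_right_iff_of_coprime hj).mp hug)]
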